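/- **Setting.** A stabiliser code on $n$ qubits is given by commuting Pauli operators (checks) $s_1,\dots,s_m$ generating its stabiliser group $\mathcal S$ (with $-1\notin\mathcal S$); Pauli operators are taken up to phase. The syndrome $\sigma(e)\in\mathbb F_2^m$ of a Pauli operator $e$ records which checks anti-commute with $e$. The weight $|e|$ is the number of qubits on which $e$ acts non-trivially, and $d$ is the minimum weight of a Pauli operator outside $\mathcal S$ with trivial syndrome ($d=\infty$ if there is none). Let $\mathcal Q$ be either the group of all Pauli operators or the group of Pauli-$Z$ operators. For $e\in\mathcal Q$ put $|e|^{\mathrm{red}}=\min\{|eq| : q\in\mathcal Q,\ \sigma(eq)=\sigma(e)\}$ (for $Z$-errors on a CSS code the minimum over all Pauli operators $q$ is the same). The code has $(t,f)$-confinement for $\mathcal Q$ if $f$ is increasing, $f(0)=0$, and $f(|\sigma(e)|)\ge|e|^{\mathrm{red}}$ for all $e\in\mathcal Q$ with $|e|^{\mathrm{red}}\le t$. A family of codes has *good linear confinement* for $\mathcal Q$ if there is an integer $\kappa>0$ such that each code of the family has $(t,f)$-confinement for $\mathcal Q$ with $f(x)=\kappa x$ and with $t\in\Omega(n^{b'})$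 for some $b'>0$. For $\mathcal Q$ the $Z$-operators this is called good linear $X$-confinement. *Noise and decoding.* A single-shot decoder is a map $D$ from syndromes to Pauli operators. Starting from $r^0=1$, cycle $\tau=1,\dots,N$ adds a random qubit error $e^\tau\in\mathcal Q$ and a random syndrome error $s_e^\tau$, and leaves the residual error $r^\tau=\hat e^\tau\cdot D(\sigma(\hat e^\tau)+s_e^\tau)$, where $\hat e^\tau=r^{\tau-1}e^\tau$. The noise is local stochastic of parameters $(p,q)$ if, in each cycle, every set $G$ of qubits is contained in the support of $e^\tau$ with probability at most $p^{|G|}$ and every set $G$ of checks is contained in the support of $s_e^\tau$ with probability at most $q^{|G|}$; correlations between cycles and between qubit and syndrome errors are arbitrary. After $N$ cycles one noiseless round of syndrome extraction and decoding is performed; the procedure fails if $r^N\cdot D(\sigma(r^N))\notin\mathcal S$. Let $P_{\mathrm{fail}}(N,p,q)$ be the supremum of the failure probability over all such noise. A family of codes has a *sustainable single-shot threshold* for local stochastic noise in $\mathcal Q$ if there are a decoder for each code and $p_{\mathrm{th}},q_{\mathrm{th}}>0$, independent of $N$ and of the noise, such that for all $0\le p<p_{\mathrm{th}}$, $0\le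 q<q_{\mathrm{th}}$ and all $N$ one has $P_{\mathrm{fail}}(N,p,q)\to0$ as $n\to\infty$; and moreover, for some constants $A,c,\beta>0$, for every code of the family, all $N$ and all $0\le p\le p_{\mathrm{th}}$, $0\le q\le q_{\mathrm{th}}$, $$P_{\mathrm{fail}}(N,p,q)\le A\,N\,n\left[\left(\frac p{p_{\mathrm{th}}}\right)^{c\,n^{\beta}}+\left(\frac q{q_{\mathrm{th}}}\right)^{c\,n^{\beta}}\right].$$ **Theorem.** Consider a family of quantum-LDPC stabiliser codes in which each qubit is in the support of at most $\omega-1$ checks and the weight of every check is at most a constant $r$, and suppose that $d\ge a\,n^b$ for all codes of the family, with constants $a,b>0$. If the family has good linear confinement for all Pauli errors, then it has a sustainable single-shot threshold for local stochastic Pauli noise. If the family has good linear $X$-confinement, then it has a sustainable single-shot threshold for local stochastic Pauli-$Z$ noise. -/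

import Mathlib

open Filter Topology
open scoped ENNReal

/-- Pauli operators on `n` qubits modulo phase: qubit `i` carries `(x, z)`, standing for `X^x Z^z`.
The product of Pauli operators is addition. -/
abbrev Pauli (n : ℕ) : Type := Fin n → ZMod 2 × ZMod 2

/-- The commutation form: `0` if the two operators commute, `1` if they anti-commute. -/
def Pauli.comm {n : ℕ} (p q : Pauli n) : ZMod 2 :=
  ∑ i, ((p i).1 * (q i).2 + (p i).2 * (q i).1)

/-- The set of qubits on which a Pauli operator acts non-trivially. Its size, the weight of `p`, is
`hammingNorm p`. -/
def Pauli.supp {n : ℕ} (p : Pauli n) : Finset (Fin n) := Finset.univ.filter fun i => p i ≠ 0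

/-- The Pauli-`Z` operators: those with no `X`-part. -/
def pauliZ (n : ℕ) : Submodule (ZMod 2) (Pauli n) where
  carrier := {p | ∀ i, (p i).1 = 0}
  zero_mem' := fun _ => rfl
  add_mem' := fun {p q} hp hq i => by
    have h1 := hp i
    have h2 := hq i
    simp [h1, h2]
  smul_mem' := fun c p hp i => by
    have h1 := hp i
    simp [h1]

/-- All Pauli operators. -/
def pauliAll (n : ℕ) : Submodule (ZMod 2) (Pauli n) := ⊤

/-- A stabiliser code on `n` qubits, given by `m` commuting generators (checks), possibly redundant.
Generators are taken modulo phase; as they commute, signs can be chosen such that the group they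
generate does not contain `-1`, and that choice affects nothing below. -/
structure StabilizerCode where
  n : ℕ
  m : ℕ
  gen : Fin m → Pauli n
  gen_comm : ∀ i j, (gen i).comm (gen j) = 0

namespace StabilizerCode

/-- The stabiliser group, modulo phase. -/
def stabilizer (C : StabilizerCode) : Submodule (ZMod 2) (Pauli C.n) :=
  Submodule.span (ZMod 2) (Set.range C.gen)

/-- The syndrome map; `hammingNorm (C.syndrome p)` is the weight of the syndrome. -/
def syndrome (C : StabilizerCode) (p : Pauli C.n) : Fin C.m → ZMod 2 := fun j => (C.gen j).comm p

/-- The distance: the minimum weight of a Pauli operator outside the stabiliser group with trivial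
syndrome (`⊤` if there is none, that is, if no logical qubit is encoded). -/
noncomputable def distance (C : StabilizerCode) : ℕ∞ :=
  ⨅ (p : Pauli C.n) (_ : p ∉ C.stabilizer) (_ : C.syndrome p = 0), (hammingNorm p : ℕ∞)

/-- The number of checks that act non-trivially on the qubit `v`. -/
def qubitDegree (C : StabilizerCode) (v : Fin C.n) : ℕ :=
  (Finset.univ.filter fun j => C.gen j v ≠ 0).card

/-- The reduced weight of `e` for the error class `Q`: the minimum of `|e q|` over `q` in `Q` such that
`e q` has the same syndrome as `e`. -/
noncomputable def reducedWeight (C : StabilizerCode) (Q : Submodule (ZMod 2) (Pauli C.n))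
    (e : Pauli C.n) : ℕ :=
  sInf {w | ∃ q ∈ Q, C.syndrome (e + q) = C.syndrome e ∧ hammingNorm (e + q) = w}

/-- `(t, f)`-confinement for errors in the class `Q`. -/
def HasConfinement (C : StabilizerCode) (Q : Submodule (ZMod 2) (Pauli C.n)) (t : ℤ) (f : ℤ → ℤ) :
    Prop :=
  Monotone f ∧ f 0 = 0 ∧ ∀ e ∈ Q, (C.reducedWeight Q e : ℤ) ≤ t →
    (C.reducedWeight Q e : ℤ) ≤ f (hammingNorm (C.syndrome e))

/-- In a CSS code every generator is an `X`-operator or a `Z`-operator. -/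
def IsCSS (C : StabilizerCode) : Prop :=
  ∀ j, (∀ v, (C.gen j v).2 = 0) ∨ (∀ v, (C.gen j v).1 = 0)

/-- For a `Z`-error on a CSS code it makes no difference whether the reduced weight is the minimum over
`Z`-operators or over all Pauli operators. -/
theorem IsCSS.reducedWeight_eq {C : StabilizerCode} (hC : C.IsCSS) {e : Pauli C.n}
    (he : e ∈ pauliZ C.n) :
    C.reducedWeight (pauliZ C.n) e = C.reducedWeight (pauliAll C.n) e := by
  have he' : ∀ i, (e i).1 = 0 := he
  apply le_antisymm
  · have hne : {w | ∃ q ∈ pauliAll C.n, C.syndrome (e + q) = C.syndrome e ∧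
        hammingNorm (e + q) = w}.Nonempty := ⟨_, 0, Submodule.zero_mem _, by simp, rfl⟩
    obtain ⟨q, -, hs, hw⟩ := Nat.sInf_mem hne
    change C.reducedWeight (pauliZ C.n) e ≤ sInf _
    rw [← hw]
    let q' : Pauli C.n := fun i => (0, (q i).2)
    refine le_trans (Nat.sInf_le ⟨q', fun i => rfl, ?_, rfl⟩) ?_
    · funext j
      have hj := congrFun hs j
      rcases hC j with h | h
      · rw [← hj]
        simp [syndrome, Pauli.comm, q', h]
      · simp [syndrome, Pauli.comm, q', h, he']
    · unfold hammingNorm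
      apply Finset.card_le_card
      intro i hi
      simp only [Finset.mem_filter, Finset.mem_univ, true_and, Pi.add_apply, ne_eq] at hi ⊢
      intro h0
      apply hi
      have h2 := congrArg Prod.snd h0
      ext
      · simp [q', he' i]
      · simpa [q'] using h2
  · apply Nat.sInf_le
    have hne : {w | ∃ q ∈ pauliZ C.n, C.syndrome (e + q) = C.syndrome e ∧
        hammingNorm (e + q) = w}.Nonempty := ⟨_, 0, Submodule.zero_mem _, by simp, rfl⟩
    obtain ⟨q, -, hs, hw⟩ := Nat.sInf_mem hne
    exact ⟨q, Submodule.mem_top, hs, hw⟩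

/-- A single-shot decoder: from one noisy syndrome it computes a recovery operator. -/
abbrev Decoder (C : StabilizerCode) : Type := (Fin C.m → ZMod 2) → Pauli C.n

/-- The noise of one cycle: the new qubit error and the syndrome error. -/
abbrev Noise (C : StabilizerCode) : Type := Pauli C.n × (Fin C.m → ZMod 2)

/-- One cycle of noise, noisy syndrome extraction and decoding, mapping the residual error `r` left by
the previous cycle to the new residual error. -/
def cycle (C : StabilizerCode) (D : C.Decoder) (r : Pauli C.n) (x : C.Noise) : Pauli C.n :=
  (r + x.1) + D (C.syndrome (r + x.1) + x.2)

/-- The residual error after `N` noisy cycles with noise `h 0, …, h (N - 1)`, starting without error. -/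
def residual (C : StabilizerCode) (D : C.Decoder) {N : ℕ} (h : Fin N → C.Noise) : Pauli C.n :=
  Fin.foldl N (fun r τ => C.cycle D r (h τ)) 0

/-- Failure: after `N` noisy cycles and one noiseless round of syndrome extraction and decoding, the
remaining error is not in the stabiliser group. -/
def Fails (C : StabilizerCode) (D : C.Decoder) {N : ℕ} (h : Fin N → C.Noise) : Prop :=
  C.cycle D (C.residual D h) 0 ∉ C.stabilizer

/-- `N` cycles of local stochastic noise with errors in the class `Q`: in every cycle, each set `G` of
qubits is contained in the support of the new qubit error with probability at most `p ^ |G|`, and each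
set `G` of checks is contained in the support of the syndrome error with probability at most
`q ^ |G|`. Correlations between cycles, and between qubit and syndrome errors, are arbitrary. -/
structure IsLocalStochastic (C : StabilizerCode) (Q : Submodule (ZMod 2) (Pauli C.n)) {N : ℕ}
    (μ : PMF (Fin N → C.Noise)) (p q : ℝ) : Prop where
  mem : ∀ h ∈ μ.support, ∀ τ, (h τ).1 ∈ Q
  qubit : ∀ (τ : Fin N) (G : Finset (Fin C.n)),
    μ.toOuterMeasure {h | G ⊆ (h τ).1.supp} ≤ ENNReal.ofReal (p ^ G.card)
  check : ∀ (τ : Fin N) (G : Finset (Fin C.m)),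
    μ.toOuterMeasure {h | ∀ j ∈ G, (h τ).2 j ≠ 0} ≤ ENNReal.ofReal (q ^ G.card)

/-- The worst failure probability of the decoder `D` after `N` cycles, over all local stochastic noise
of parameters `p` (qubits) and `q` (syndromes) with errors in the class `Q`. -/
noncomputable def worstFailure (C : StabilizerCode) (Q : Submodule (ZMod 2) (Pauli C.n))
    (D : C.Decoder) (N : ℕ) (p q : ℝ) : ℝ≥0∞ :=
  ⨆ (μ : PMF (Fin N → C.Noise)) (_ : C.IsLocalStochastic Q μ p q),
    μ.toOuterMeasure {h | C.Fails D h}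

end StabilizerCode

/-- A family of codes has good confinement with respect to `f`, for errors in the class `Q`: each code
is `(t, f)`-confined, with the same `f`, and `t ∈ Ω(n ^ b)` for some `b > 0`. -/
def GoodConfinement {ι : Type*} (C : ι → StabilizerCode)
    (Q : (n : ℕ) → Submodule (ZMod 2) (Pauli n)) (f : ℤ → ℤ) : Prop :=
  ∃ t : ι → ℤ,
    (∃ b : ℝ, 0 < b ∧ ∃ c : ℝ, 0 < c ∧ ∃ n₀ : ℕ, ∀ i, n₀ ≤ (C i).n →
      c * ((C i).n : ℝ) ^ b ≤ (t i : ℝ)) ∧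
    ∀ i, (C i).HasConfinement (Q (C i).n) (t i) f

/-- Good linear confinement: good confinement with respect to `f x = κ x` for some `κ > 0`. -/
def GoodLinearConfinement {ι : Type*} (C : ι → StabilizerCode)
    (Q : (n : ℕ) → Submodule (ZMod 2) (Pauli n)) : Prop :=
  ∃ κ : ℤ, 0 < κ ∧ GoodConfinement C Q (fun x => κ * x)

/-- A sustainable single-shot threshold for local stochastic noise in the class `Q`. There are one
single-shot decoder for each code and intensities `pth, qth > 0`, all independent of the number of
cycles and of the noise, such that:
* below `pth` and `qth`, for every number `N` of cycles, the worst failure probability tends to `0` as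
  `n → ∞`; so the threshold for `N` cycles stays bounded away from `0` as `N → ∞`;
* the failure probability is at most `A N n ((p / pth) ^ (c n ^ β) + (q / qth) ^ (c n ^ β))`, that is,
  linear in `N` and exponentially small in a power of `n`. -/
def HasSustainableThreshold {ι : Type*} (C : ι → StabilizerCode)
    (Q : (n : ℕ) → Submodule (ZMod 2) (Pauli n)) : Prop :=
  ∃ (D : (i : ι) → (C i).Decoder) (pth qth : ℝ), 0 < pth ∧ 0 < qth ∧
    (∀ (N : ℕ) (p q : ℝ), 0 ≤ p → p < pth → 0 ≤ q → q < qth →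
      Tendsto (fun i => (C i).worstFailure (Q (C i).n) (D i) N p q)
        (comap (fun i => (C i).n) atTop) (𝓝 0)) ∧
    ∃ A c β : ℝ, 0 < A ∧ 0 < c ∧ 0 < β ∧
      ∀ (i : ι) (N : ℕ) (p q : ℝ), 0 ≤ p → p ≤ pth → 0 ≤ q → q ≤ qth →
        (C i).worstFailure (Q (C i).n) (D i) N p q ≤
          ENNReal.ofReal (A * N * (C i).n *
            ((p / pth) ^ (c * ((C i).n : ℝ) ^ β) + (q / qth) ^ (c * ((C i).n : ℝ) ^ β)))

/-! Sustainable thresholds from linear confinement.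

The decoder minimises `|x| + 2 κ |s + σ(x)|` over the recovery operators `x` of the class. This objective
is local: call two qubits adjacent if they share a check; then distinct connected components of a set of
qubits touch disjoint sets of checks, and the recovery is optimal on each component separately
(`IsMinWeightDecoder.exchange`).

The state of the memory after a cycle is described by an operator `R` of minimal weight with the
syndrome of the residual error. As `R` is minimal, each of its components is its own reduced error, so
that confinement applies to components of fewer than `T` qubits, however heavy `R` is as a whole.
Confinement and the optimality of the recovery bound the component by `4 κ` times the weight of the
syndrome error of that very cycle on its checks (`IsMinWeightDecoder.card_le_of_confined`). So the memory
of earlier cycles is lost, which makes the threshold sustainable; and after a cycle without syndrome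
error `R` is trivial.

In the next cycle, consider a component `M` of the new errors. Optimality bounds `|M|` by the errors
present on `M` before the decoding (`IsMinWeightDecoder.card_le`); those left by the previous cycle are
in turn bounded by its syndrome error. Adding to `M` the components of the previous `R` that meet it
gives a connected set a constant fraction of which consists of fresh qubit errors or of syndrome errors
of the last two cycles. If no such set of `T` or more qubits exists, all components have fewer than `T`
qubits, which gives confinement for the next step, and shows that the residual error and `R` differ by
operators of trivial syndrome and weight below the distance, hence by a stabiliser
(`IsControlled.cycle`, `not_fails_of_isSparse`).

Connected sets of `s` qubits number at most `n Δ ^ (2 s)`, so by a Peierls argument such a set exists with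
probability at most `n` times `(p / pth) ^ (T / 12)` or `(q / qth) ^ (T / (60 κ))`
(`dense_cluster_prob_le`), and a union bound over the cycles gives a failure probability linear in `N`.
Only the marginals of each cycle enter, so correlations do not matter. Finally `T` can be taken of the
order of a power of `n` (`exists_scale`). -/

/-! ### Connected and isolated sets of a symmetric relation -/

section Connectivity

variable {V : Type*}

/-- `M` is connected for the relation `adj`: every nonempty proper subset of `M` is related to its
complement in `M`. The empty set counts as connected. -/
def IsConn (adj : V → V → Prop) (M : Finset V) : Prop :=
  ∀ W ⊆ M, W.Nonempty → W ≠ M → ∃ x ∈ W, ∃ y ∈ M, y ∉ W ∧ adj x y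

/-- `A` is a union of connected components of `B` for the relation `adj`. -/
def IsIsolated (adj : V → V → Prop) (A B : Finset V) : Prop :=
  A ⊆ B ∧ ∀ x ∈ A, ∀ y ∈ B, y ∉ A → ¬ adj x y

variable {adj : V → V → Prop}

theorem IsIsolated.refl (adj : V → V → Prop) (B : Finset V) : IsIsolated adj B B :=
  ⟨subset_rfl, fun _ _ _ hy hy' => (hy' hy).elim⟩

/-- A property of the isolated subsets of `B` may be checked on connected sets, provided it passes to
disjoint unions. -/
theorem IsIsolated.induction [DecidableEq V] (hsymm : ∀ x y, adj x y → adj y x) {B : Finset V}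
    {P : Finset V → Prop} (empty : P ∅)
    (conn : ∀ A, IsIsolated adj A B → A.Nonempty → IsConn adj A → P A)
    (union : ∀ A A', IsIsolated adj A B → IsIsolated adj A' B → Disjoint A A' → P A → P A' →
      P (A ∪ A')) :
    ∀ A, IsIsolated adj A B → P A := by
  intro A
  induction A using Finset.strongInduction with
  | H A ih =>
    intro hA
    rcases A.eq_empty_or_nonempty with rfl | hne
    · exact empty
    by_cases hc : IsConn adj A
    · exact conn A hA hne hc
    unfold IsConn at hc
    push Not at hc
    obtain ⟨W, hW, hWne, hWA, hcut⟩ := hc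
    have h1 : IsIsolated adj W B := by
      refine ⟨hW.trans hA.1, fun x hx y hy hyW => ?_⟩
      by_cases hyA : y ∈ A
      · exact hcut x hx y hyA hyW
      · exact hA.2 x (hW hx) y hy hyA
    have h2 : IsIsolated adj (A \ W) B := by
      refine ⟨Finset.sdiff_subset.trans hA.1, fun x hx y hy hyW hxy => ?_⟩
      rw [Finset.mem_sdiff] at hx hyW
      by_cases hyA : y ∈ A
      · exact hcut y (by tauto) x hx.1 hx.2 (hsymm _ _ hxy)
      · exact hA.2 x hx.1 y hy hyA hxy
    have hd : Disjoint W (A \ W) := Finset.disjoint_sdiff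
    have key := union W (A \ W) h1 h2 hd (ih W (hW.ssubset_of_ne hWA) h1)
      (ih _ (Finset.sdiff_ssubset hW hWne) h2)
    rwa [Finset.union_sdiff_of_subset hW] at key

/-- The union `A` of the connected components of `B` that meet a connected set `M`; adding it to `M`
keeps `M` connected. -/
theorem IsConn.exists_hull [DecidableEq V] (hsymm : ∀ x y, adj x y → adj y x) {M : Finset V}
    (hM : IsConn adj M) (B : Finset V) :
    ∃ A, IsIsolated adj A B ∧ M ∩ B ⊆ A ∧ IsConn adj (M ∪ A) := by
  classical
  obtain ⟨A, hA, hmin⟩ := Finset.exists_min_image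
    (B.powerset.filter fun A => IsIsolated adj A B ∧ M ∩ B ⊆ A) Finset.card
    ⟨B, by simp [IsIsolated.refl]⟩
  simp only [Finset.mem_filter, Finset.mem_powerset, and_imp] at hA hmin
  obtain ⟨hAB, hiso, hMA⟩ := hA
  refine ⟨A, hiso, hMA, ?_⟩
  -- A set without relations to its complement in `M ∪ A` contains `A` as soon as it contains `M`.
  have absorb : ∀ W ⊆ M ∪ A, M ⊆ W → (∀ x ∈ W, ∀ y ∈ M ∪ A, y ∉ W → ¬ adj x y) → A ⊆ W := by
    intro W _ hMW hcut
    have hi : IsIsolated adj (A ∩ W) B := by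
      refine ⟨Finset.inter_subset_left.trans hAB, fun x hx y hy hyAW => ?_⟩
      rw [Finset.mem_inter] at hx hyAW
      by_cases hyA : y ∈ A
      · exact hcut x hx.2 y (Finset.mem_union_right _ hyA) (by tauto)
      · exact hiso.2 x hx.1 y hy hyA
    have := hmin (A ∩ W) (Finset.inter_subset_left.trans hAB) hi
      (Finset.subset_inter hMA (Finset.inter_subset_left.trans hMW))
    rw [← Finset.eq_of_subset_of_card_le Finset.inter_subset_left this]
    exact Finset.inter_subset_right
  intro W hW hWne hWM
  by_contra hcon
  push Not at hcon
  have hcon' : ∀ x ∈ (M ∪ A) \ W, ∀ y ∈ M ∪ A, y ∉ (M ∪ A) \ W → ¬ adj x y := by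
    intro x hx y hy hy' hxy
    rw [Finset.mem_sdiff] at hx hy'
    exact hcon y (by tauto) x hx.1 hx.2 (hsymm _ _ hxy)
  -- As `M` is connected, it lies on one side of the cut.
  have hside : M ⊆ W ∨ M ⊆ (M ∪ A) \ W := by
    by_cases h1 : (M ∩ W).Nonempty
    · left
      by_contra h2
      obtain ⟨x, hx, y, hy, hyW, hxy⟩ := hM (M ∩ W) Finset.inter_subset_left h1
        (fun h => h2 (Finset.inter_eq_left.1 h))
      rw [Finset.mem_inter] at hx hyW
      exact hcon x hx.2 y (Finset.mem_union_left _ hy) (by tauto) hxy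
    · right
      intro x hx
      rw [Finset.mem_sdiff]
      exact ⟨Finset.mem_union_left _ hx, fun hxW => h1 ⟨x, Finset.mem_inter.2 ⟨hx, hxW⟩⟩⟩
  rcases hside with h | h
  · exact hWM (hW.antisymm (Finset.union_subset h (absorb W hW h hcon)))
  · have h2 := absorb _ Finset.sdiff_subset h hcon'
    obtain ⟨x, hx⟩ := hWne
    have : x ∈ (M ∪ A) \ W := Finset.union_subset h h2 (hW hx)
    exact (Finset.mem_sdiff.1 this).2 hx

/-! ### Counting connected sets -/

/-- The walks of length `k` from `v`, as lists of `k + 1` vertices, where `nbr x` holds the possible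
successors of `x`. -/
def walksFrom [DecidableEq V] (nbr : V → Finset V) : ℕ → V → Finset (List V)
  | 0, v => {[v]}
  | k + 1, v => (nbr v).biUnion fun w => (walksFrom nbr k w).image (v :: ·)

theorem card_walksFrom_le [DecidableEq V] {nbr : V → Finset V} {Δ : ℕ}
    (hΔ : ∀ v, (nbr v).card ≤ Δ) (k : ℕ) (v : V) : (walksFrom nbr k v).card ≤ Δ ^ k := by
  induction k generalizing v with
  | zero => simp [walksFrom]
  | succ k ih =>
    rw [walksFrom, pow_succ']
    refine (Finset.card_biUnion_le_card_mul _ _ (Δ ^ k) fun w _ =>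
      Finset.card_image_le.trans (ih w)).trans (Nat.mul_le_mul_right _ (hΔ v))

theorem mem_walksFrom [DecidableEq V] {nbr : V → Finset V} (l : List V) (v : V)
    (h : List.IsChain (fun x y => y ∈ nbr x) (v :: l)) : v :: l ∈ walksFrom nbr l.length v := by
  induction l generalizing v with
  | nil => simp [walksFrom]
  | cons w l ih =>
    rw [List.isChain_cons_cons] at h
    simp only [List.length_cons, walksFrom, Finset.mem_biUnion, Finset.mem_image]
    exact ⟨w, h.1, _, ih w h.2, rfl⟩

/-- A connected set is exhausted by a walk that visits each further vertex by a detour back and forth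
along one edge; this costs two steps per vertex. -/
theorem IsConn.exists_walk [DecidableEq V] {nbr : V → Finset V}
    (hsymm : ∀ x y, y ∈ nbr x → x ∈ nbr y) {M : Finset V} (hM : IsConn (fun x y => y ∈ nbr x) M)
    {v : V} (hv : v ∈ M) :
    ∃ l ∈ walksFrom nbr (2 * (M.card - 1)) v, l.toFinset = M := by
  have main : ∀ k < M.card, ∃ l : List V, List.IsChain (fun x y => y ∈ nbr x) (v :: l) ∧
      l.length = 2 * k ∧ (v :: l).toFinset ⊆ M ∧ (v :: l).toFinset.card = k + 1 := by
    intro k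
    induction k with
    | zero => exact fun _ => ⟨[], by simp, by simp, by simpa using hv, by simp⟩
    | succ k ih =>
      intro hk
      obtain ⟨l, hc, hl, hlM, hcard⟩ := ih (by omega)
      obtain ⟨x, hx, y, hy, hyl, hxy⟩ := hM (v :: l).toFinset hlM ⟨v, by simp⟩ (by
        intro h; rw [h] at hcard; omega)
      rw [List.mem_toFinset] at hx
      obtain ⟨l₁, l₂, hs⟩ := List.append_of_mem hx
      have hnew : List.IsChain (fun x y => y ∈ nbr x) (l₁ ++ x :: y :: x :: l₂) := by
        rw [hs, List.isChain_split] at hc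
        rw [List.isChain_split, List.isChain_cons_cons, List.isChain_cons_cons]
        exact ⟨hc.1, hxy, hsymm _ _ hxy, hc.2⟩
      have hfin : (l₁ ++ x :: y :: x :: l₂).toFinset = insert y (v :: l).toFinset := by
        rw [hs]; ext z; simp only [List.mem_toFinset, List.mem_append, List.mem_cons,
          Finset.mem_insert]; tauto
      have hlen : (l₁ ++ x :: y :: x :: l₂).length = 2 * (k + 1) + 1 := by
        have := congrArg List.length hs
        simp only [List.length_cons, List.length_append] at this ⊢
        omega
      -- The head is still `v`.
      obtain ⟨l', hl'⟩ : ∃ l', l₁ ++ x :: y :: x :: l₂ = v :: l' := by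
        cases l₁ with
        | nil =>
          simp only [List.nil_append, List.cons.injEq] at hs
          exact ⟨y :: x :: l₂, by simp [hs.1]⟩
        | cons z l₁ =>
          simp only [List.cons_append, List.cons.injEq] at hs
          exact ⟨_, by rw [List.cons_append, hs.1]⟩
      rw [hl'] at hnew hfin hlen
      refine ⟨l', hnew, by simpa using hlen, ?_, ?_⟩
      · rw [hfin]; exact Finset.insert_subset hy hlM
      · rw [hfin, Finset.card_insert_of_notMem hyl, hcard]
  have hpos : 0 < M.card := Finset.card_pos.2 ⟨v, hv⟩
  obtain ⟨l, hc, hl, hlM, hcard⟩ := main (M.card - 1) (by omega)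
  refine ⟨v :: l, ?_, Finset.eq_of_subset_of_card_le hlM (by omega)⟩
  rw [← hl]
  exact mem_walksFrom l v hc

open Classical in
/-- In a graph of degree at most `Δ`, the connected sets of `s` vertices are exponentially few in
`s`. -/
theorem card_isConn_le [Fintype V] {nbr : V → Finset V}
    (hsymm : ∀ x y, y ∈ nbr x → x ∈ nbr y) {Δ : ℕ} (hΔ : ∀ v, (nbr v).card ≤ Δ) (hΔ1 : 1 ≤ Δ)
    {s : ℕ} (hs : 1 ≤ s) :
    (Finset.univ.filter fun M : Finset V => IsConn (fun x y => y ∈ nbr x) M ∧ M.card = s).card ≤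
      Fintype.card V * (Δ ^ 2) ^ s := by
  have hsub : (Finset.univ.filter fun M : Finset V =>
      IsConn (fun x y => y ∈ nbr x) M ∧ M.card = s) ⊆
      (Finset.univ : Finset V).biUnion fun v =>
        (walksFrom nbr (2 * (s - 1)) v).image List.toFinset := by
    intro M hM
    simp only [Finset.mem_filter, Finset.mem_univ, true_and] at hM
    obtain ⟨hc, rfl⟩ := hM
    obtain ⟨v, hv⟩ := Finset.card_pos.1 hs
    simp only [Finset.mem_biUnion, Finset.mem_univ, true_and, Finset.mem_image]
    exact ⟨v, hc.exists_walk hsymm hv⟩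
  refine (Finset.card_le_card hsub).trans ((Finset.card_biUnion_le_card_mul _ _
    ((Δ ^ 2) ^ s) fun v _ => Finset.card_image_le.trans ((card_walksFrom_le hΔ _ v).trans ?_)).trans
    le_rfl)
  rw [← pow_mul]
  exact Nat.pow_le_pow_right hΔ1 (by omega)

end Connectivity

/-! ### Weights and restrictions -/

section Weight

variable {ι G : Type*} [DecidableEq G]

/-- The weight of `x` on the set `J` of positions. -/
def wtOn [Zero G] (x : ι → G) (J : Finset ι) : ℕ := (J.filter fun i => x i ≠ 0).card

/-- The restriction of `x` to `J`, extended by zero. -/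
def restrict [DecidableEq ι] {M : Type*} [Zero M] (J : Finset ι) (x : ι → M) : ι → M :=
  fun i => if i ∈ J then x i else 0

theorem wtOn_le_card [Zero G] (x : ι → G) (J : Finset ι) : wtOn x J ≤ J.card :=
  Finset.card_filter_le _ _

theorem wtOn_mono [Zero G] (x : ι → G) {J K : Finset ι} (h : J ⊆ K) : wtOn x J ≤ wtOn x K :=
  Finset.card_le_card (Finset.filter_subset_filter _ h)

theorem wtOn_congr [Zero G] {x y : ι → G} {J : Finset ι} (h : ∀ i ∈ J, x i = y i) :
    wtOn x J = wtOn y J := by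
  unfold wtOn
  rw [Finset.filter_congr fun i hi => by rw [h i hi]]

theorem wtOn_zero [Zero G] (J : Finset ι) : wtOn (0 : ι → G) J = 0 := by simp [wtOn]

theorem wtOn_union [DecidableEq ι] [Zero G] (x : ι → G) {J K : Finset ι} (h : Disjoint J K) :
    wtOn x (J ∪ K) = wtOn x J + wtOn x K := by
  unfold wtOn
  rw [Finset.filter_union, Finset.card_union_of_disjoint (Finset.disjoint_filter_filter h)]

theorem wtOn_add_le [AddZeroClass G] (x y : ι → G) (J : Finset ι) :
    wtOn (x + y) J ≤ wtOn x J + wtOn y J := by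
  classical
  unfold wtOn
  refine (Finset.card_le_card fun i hi => ?_).trans (Finset.card_union_le _ _)
  simp only [Finset.mem_union, Finset.mem_filter, Pi.add_apply] at hi ⊢
  by_contra h
  have h1 : x i = 0 := by tauto
  have h2 : y i = 0 := by tauto
  exact hi.2 (by simp [h1, h2])

theorem restrict_union [DecidableEq ι] {M : Type*} [AddZeroClass M] (x : ι → M) {J K : Finset ι}
    (h : Disjoint J K) : restrict (J ∪ K) x = restrict J x + restrict K x := by
  funext i
  by_cases h1 : i ∈ J
  · have : i ∉ K := Finset.disjoint_left.1 h h1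
    simp [restrict, h1, this]
  · by_cases h2 : i ∈ K <;> simp [restrict, h1, h2]

theorem hammingNorm_add_le [Fintype ι] [AddZeroClass G] (x y : ι → G) :
    hammingNorm (x + y) ≤ hammingNorm x + hammingNorm y :=
  wtOn_add_le x y Finset.univ

variable [Fintype ι] [DecidableEq ι]

/-- Two vectors that agree off `J` differ in weight as they do on `J`. -/
theorem hammingNorm_add_wtOn [Zero G] {x y : ι → G} {J : Finset ι} (h : ∀ i ∉ J, x i = y i) :
    hammingNorm x + wtOn y J = hammingNorm y + wtOn x J := by
  have key : ∀ z : ι → G, hammingNorm z = wtOn z J + wtOn z Jᶜ := fun z => by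
    rw [← wtOn_union z disjoint_compl_right, Finset.union_compl]; rfl
  rw [key x, key y, wtOn_congr (J := Jᶜ) fun i hi => h i (Finset.mem_compl.1 hi)]
  omega

theorem hammingNorm_restrict [Zero G] (x : ι → G) (J : Finset ι) :
    hammingNorm (restrict J x) = wtOn x J := by
  unfold hammingNorm wtOn restrict
  congr 1
  ext i
  simp

end Weight

theorem Pauli.mem_supp {n : ℕ} {p : Pauli n} {i : Fin n} : i ∈ p.supp ↔ p i ≠ 0 := by
  simp [Pauli.supp]

theorem wtOn_eq_card_of_subset_supp {n : ℕ} {p : Pauli n} {J : Finset (Fin n)} (h : J ⊆ p.supp) :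
    wtOn p J = J.card := by
  unfold wtOn
  rw [Finset.filter_true_of_mem fun i hi => Pauli.mem_supp.1 (h hi)]

theorem Pauli.restrict_supp {n : ℕ} {p : Pauli n} {J : Finset (Fin n)} (h : p.supp ⊆ J) :
    restrict J p = p := by
  funext i
  by_cases hi : i ∈ J
  · simp [restrict, hi]
  · have : p i = 0 := by
      by_contra h0
      exact hi (h (Pauli.mem_supp.2 h0))
    simp [restrict, this]

theorem Pauli.add_self {n : ℕ} (p : Pauli n) : p + p = 0 := by
  funext i
  ext <;> exact CharTwo.add_self_eq_zero _

namespace StabilizerCode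

variable (C : StabilizerCode)

/-! ### Locality of the syndrome -/

/-- Two qubits are adjacent if some check acts on both. -/
def Adj (x y : Fin C.n) : Prop := ∃ j, C.gen j x ≠ 0 ∧ C.gen j y ≠ 0

/-- The checks that act on some qubit of `M`. -/
def checksOn (M : Finset (Fin C.n)) : Finset (Fin C.m) :=
  Finset.univ.filter fun j => ∃ v ∈ M, C.gen j v ≠ 0

variable {C}

theorem Adj.symm {x y : Fin C.n} : C.Adj x y → C.Adj y x := fun ⟨j, h1, h2⟩ => ⟨j, h2, h1⟩

theorem mem_checksOn {M : Finset (Fin C.n)} {j : Fin C.m} :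
    j ∈ C.checksOn M ↔ ∃ v ∈ M, C.gen j v ≠ 0 := by
  simp [checksOn]

theorem checksOn_mono {M M' : Finset (Fin C.n)} (h : M ⊆ M') : C.checksOn M ⊆ C.checksOn M' := by
  intro j hj
  rw [mem_checksOn] at hj ⊢
  obtain ⟨v, hv, hj⟩ := hj
  exact ⟨v, h hv, hj⟩

theorem checksOn_union (M M' : Finset (Fin C.n)) :
    C.checksOn (M ∪ M') = C.checksOn M ∪ C.checksOn M' := by
  ext j
  simp only [mem_checksOn, Finset.mem_union, or_and_right, exists_or]

theorem disjoint_checksOn {A A' B : Finset (Fin C.n)} (hA : IsIsolated C.Adj A B)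
    (hA' : IsIsolated C.Adj A' B) (h : Disjoint A A') :
    Disjoint (C.checksOn A) (C.checksOn A') := by
  rw [Finset.disjoint_left]
  intro j hj hj'
  rw [mem_checksOn] at hj hj'
  obtain ⟨v, hv, h1⟩ := hj
  obtain ⟨w, hw, h2⟩ := hj'
  exact hA.2 v hv w (hA'.1 hw) (Finset.disjoint_right.1 h hw) ⟨j, h1, h2⟩

theorem card_checksOn_le {ω : ℕ} (hdeg : ∀ v, C.qubitDegree v + 1 ≤ ω) (M : Finset (Fin C.n)) :
    (C.checksOn M).card ≤ ω * M.card := by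
  have : C.checksOn M ⊆ M.biUnion fun v => Finset.univ.filter fun j => C.gen j v ≠ 0 := by
    intro j hj
    rw [mem_checksOn] at hj
    simpa using hj
  refine (Finset.card_le_card this).trans ((Finset.card_biUnion_le_card_mul _ _ ω fun v _ => ?_).trans
    (Nat.mul_comm _ _).le)
  exact (Nat.le_succ _).trans (hdeg v)

theorem syndrome_add (p q : Pauli C.n) : C.syndrome (p + q) = C.syndrome p + C.syndrome q := by
  funext j
  simp only [syndrome, Pauli.comm, Pi.add_apply, Prod.fst_add, Prod.snd_add,
    ← Finset.sum_add_distrib]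
  exact Finset.sum_congr rfl fun i _ => by ring

theorem syndrome_zero : C.syndrome 0 = 0 := by
  funext j
  simp [syndrome, Pauli.comm]

theorem syndrome_eq_zero_of_mem_stabilizer {p : Pauli C.n} (hp : p ∈ C.stabilizer) :
    C.syndrome p = 0 := by
  induction hp using Submodule.span_induction with
  | mem x hx =>
    obtain ⟨i, rfl⟩ := hx
    funext j
    exact C.gen_comm j i
  | zero => exact syndrome_zero
  | add x y _ _ hx hy => rw [syndrome_add, hx, hy, add_zero]
  | smul a x _ hx =>
    funext j
    have := congrFun hx j
    simp only [syndrome, Pauli.comm, Pi.zero_apply, Pi.smul_apply, Prod.smul_fst, Prod.smul_snd,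
      smul_eq_mul] at this ⊢
    calc _ = a * ∑ i, ((C.gen j i).1 * (x i).2 + (C.gen j i).2 * (x i).1) := by
          rw [Finset.mul_sum]
          exact Finset.sum_congr rfl fun i _ => by ring
      _ = 0 := by rw [this, mul_zero]

/-- The part of `p` on a union `A` of connected components of (a set containing) its support produces
exactly the part of the syndrome on the checks that act on `A`. -/
theorem syndrome_restrict {p : Pauli C.n} {A B : Finset (Fin C.n)} (hA : IsIsolated C.Adj A B)
    (hp : p.supp ⊆ B) :
    C.syndrome (restrict A p) = restrict (C.checksOn A) (C.syndrome p) := by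
  funext j
  by_cases hj : j ∈ C.checksOn A
  · simp only [restrict, hj, if_true, syndrome, Pauli.comm]
    obtain ⟨v, hv, hjv⟩ := mem_checksOn.1 hj
    refine Finset.sum_congr rfl fun i _ => ?_
    by_cases hi : i ∈ A
    · simp [hi]
    by_cases h0 : p i = 0
    · simp [hi, h0]
    · have : C.gen j i = 0 := by
        by_contra h
        exact hA.2 v hv i (hp (Pauli.mem_supp.2 h0)) hi ⟨j, hjv, h⟩
      simp [this]
  · simp only [restrict, hj, if_false, syndrome, Pauli.comm]
    refine Finset.sum_eq_zero fun i _ => ?_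
    by_cases hi : i ∈ A
    · have : C.gen j i = 0 := by
        by_contra h
        exact hj (mem_checksOn.2 ⟨i, hi, h⟩)
      simp [this]
    · simp [hi]

/-! ### The decoder -/

/-- The decoder `D` chooses, among the operators in `Q`, a recovery `x` for the noisy syndrome `s` that
minimises `|x| + 2 κ |s + σ(x)|`, where `s + σ(x)` is the syndrome error that `x` presumes. -/
def IsMinWeightDecoder (C : StabilizerCode) (Q : Submodule (ZMod 2) (Pauli C.n)) (κ : ℕ)
    (D : C.Decoder) : Prop :=
  ∀ s, D s ∈ Q ∧ ∀ x ∈ Q, hammingNorm (D s) + 2 * κ * hammingNorm (s + C.syndrome (D s)) ≤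
    hammingNorm x + 2 * κ * hammingNorm (s + C.syndrome x)

theorem exists_isMinWeightDecoder (C : StabilizerCode) (Q : Submodule (ZMod 2) (Pauli C.n)) (κ : ℕ) :
    ∃ D, C.IsMinWeightDecoder Q κ D := by
  classical
  have h : ∀ s : Fin C.m → ZMod 2, ∃ d ∈ Q, ∀ x ∈ Q,
      hammingNorm d + 2 * κ * hammingNorm (s + C.syndrome d) ≤
        hammingNorm x + 2 * κ * hammingNorm (s + C.syndrome x) := by
    intro s
    obtain ⟨d, hd, hmin⟩ := Finset.exists_min_image (Finset.univ.filter fun x => x ∈ Q)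
      (fun x => hammingNorm x + 2 * κ * hammingNorm (s + C.syndrome x)) ⟨0, by simp⟩
    simp only [Finset.mem_filter, Finset.mem_univ, true_and] at hd hmin
    exact ⟨d, hd, hmin⟩
  choose D hD using h
  exact ⟨D, hD⟩

/-- Optimality of the recovery `D s` against `D s + y`, where the syndrome of `y` is, on the set `J`,
the difference between the presumed syndrome error and `u`. -/
theorem IsMinWeightDecoder.exchange {Q : Submodule (ZMod 2) (Pauli C.n)} {κ : ℕ} {D : C.Decoder}
    (hD : C.IsMinWeightDecoder Q κ D) {s u : Fin C.m → ZMod 2} {y : Pauli C.n} (hy : y ∈ Q)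
    {J : Finset (Fin C.m)}
    (hyJ : C.syndrome y = restrict J (u + (s + C.syndrome (D s)))) :
    hammingNorm (D s) + 2 * κ * wtOn (s + C.syndrome (D s)) J ≤
      hammingNorm (D s + y) + 2 * κ * wtOn u J := by
  have h := (hD s).2 (D s + y) (Q.add_mem (hD s).1 hy)
  set v := s + C.syndrome (D s) with hv
  have hs : s + C.syndrome (D s + y) = v + C.syndrome y := by
    rw [syndrome_add, ← add_assoc]
  rw [hs] at h
  have hoff : ∀ j ∉ J, (v + C.syndrome y) j = v j := by
    intro j hj
    simp [hyJ, restrict, hj]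
  have hon : ∀ j ∈ J, (v + C.syndrome y) j = u j := by
    intro j hj
    simp only [hyJ, restrict, hj, if_true, Pi.add_apply]
    rw [add_left_comm, CharTwo.add_self_eq_zero, add_zero]
  have h2 := hammingNorm_add_wtOn hoff
  rw [wtOn_congr hon] at h2
  nlinarith

end StabilizerCode

namespace StabilizerCode

/-! ### One cycle -/

variable {C : StabilizerCode}

/-- `R` has minimal weight among the operators in `Q` with the same syndrome as `x`. -/
def IsMinRep (C : StabilizerCode) (Q : Submodule (ZMod 2) (Pauli C.n)) (x R : Pauli C.n) : Prop :=
  R ∈ Q ∧ C.syndrome R = C.syndrome x ∧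
    ∀ q ∈ Q, C.syndrome q = C.syndrome x → hammingNorm R ≤ hammingNorm q

theorem exists_isMinRep {Q : Submodule (ZMod 2) (Pauli C.n)} {x : Pauli C.n} (hx : x ∈ Q) :
    ∃ R, C.IsMinRep Q x R := by
  classical
  obtain ⟨d, hd, hmin⟩ := Finset.exists_min_image
    (Finset.univ.filter fun q => q ∈ Q ∧ C.syndrome q = C.syndrome x)
    hammingNorm ⟨x, by simp [hx]⟩
  simp only [Finset.mem_filter, Finset.mem_univ, true_and, and_imp] at hd hmin
  exact ⟨d, hd.1, hd.2, hmin⟩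

theorem IsMinRep.reducedWeight_restrict {Q : Submodule (ZMod 2) (Pauli C.n)} {x R : Pauli C.n}
    (hR : C.IsMinRep Q x R) (A : Finset (Fin C.n)) :
    C.reducedWeight Q (restrict A R) = wtOn R A := by
  rw [← hammingNorm_restrict]
  apply le_antisymm
  · exact Nat.sInf_le ⟨0, Q.zero_mem, by simp, by simp⟩
  · obtain ⟨q, hq, hs, hw⟩ := Nat.sInf_mem (s := {w | ∃ q ∈ Q,
      C.syndrome (restrict A R + q) = C.syndrome (restrict A R) ∧
        hammingNorm (restrict A R + q) = w}) ⟨_, 0, Q.zero_mem, by simp, rfl⟩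
    change _ ≤ sInf _
    rw [← hw]
    have hq0 : C.syndrome q = 0 := by simpa [syndrome_add] using hs
    have h1 := hR.2.2 (R + q) (Q.add_mem hR.1 hq) (by rw [syndrome_add, hq0, add_zero, hR.2.1])
    have h2 : R + q = restrict Aᶜ R + (restrict A R + q) := by
      rw [← add_assoc, ← restrict_union R disjoint_compl_left]
      congr 1
      funext i
      simp [restrict]
    have h3 := hammingNorm_add_le (restrict Aᶜ R) (restrict A R + q)
    rw [← h2, hammingNorm_restrict] at h3
    have h4 : hammingNorm R = wtOn R A + wtOn R Aᶜ := by
      rw [← wtOn_union R disjoint_compl_right, Finset.union_compl]; rfl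
    rw [hammingNorm_restrict]
    omega

section Cycle

variable {Q : Submodule (ZMod 2) (Pauli C.n)} {κ : ℕ} {D : C.Decoder}
  {E R : Pauli C.n} {u : Fin C.m → ZMod 2}

theorem syndrome_cycle (D : C.Decoder) (E : Pauli C.n) (u : Fin C.m → ZMod 2) :
    C.syndrome (E + D (C.syndrome E + u)) =
      u + ((C.syndrome E + u) + C.syndrome (D (C.syndrome E + u))) := by
  rw [syndrome_add]
  funext j
  simp only [Pi.add_apply]
  rw [add_comm (C.syndrome E j) (u j), add_assoc (u j), ← add_assoc (u j) (u j),
    CharTwo.add_self_eq_zero, zero_add]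

/-- On a union `A` of connected components of the errors after a cycle, the size of `A` is bounded by
the weight of the errors before the decoding: both the recovery and the representative `R` are optimal
on `A`. -/
theorem IsMinWeightDecoder.card_le (hD : C.IsMinWeightDecoder Q κ D)
    (hres : ∀ q ∈ Q, ∀ A, restrict A q ∈ Q) (hE : E ∈ Q)
    (hR : C.IsMinRep Q (E + D (C.syndrome E + u)) R) {A : Finset (Fin C.n)}
    (hA : IsIsolated C.Adj A ((E + D (C.syndrome E + u)).supp ∪ R.supp)) :
    A.card ≤ 4 * wtOn E A + 4 * κ * wtOn u (C.checksOn A) := by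
  have hcyc := syndrome_cycle D E u
  set d := D (C.syndrome E + u) with hd
  set x := E + d with hx
  have hdQ : d ∈ Q := (hD _).1
  have hxQ : x ∈ Q := Q.add_mem hE hdQ
  have hsx := syndrome_restrict hA (p := x) Finset.subset_union_left
  have hsR := syndrome_restrict hA (p := R) Finset.subset_union_right
  have h1 := hD.exchange (hres x hxQ A) (hsx.trans (by rw [hcyc]))
  rw [← hd] at h1
  have h2 : hammingNorm (d + restrict A x) + wtOn d A = hammingNorm d + wtOn E A := by
    rw [hammingNorm_add_wtOn (J := A) fun i hi => by simp [restrict, hi]]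
    congr 1
    refine wtOn_congr fun i hi => ?_
    have := congrFun (Pauli.add_self d) i
    simp only [Pi.add_apply, restrict, hi, if_true, hx] at this ⊢
    rw [add_left_comm, this, Pi.zero_apply, add_zero]
  have h3 : wtOn x A ≤ wtOn E A + wtOn d A := wtOn_add_le E d A
  have h4 : wtOn R A ≤ wtOn x A := by
    have hq : restrict A R + (R + restrict A x) ∈ Q :=
      Q.add_mem (hres R hR.1 A) (Q.add_mem hR.1 (hres x hxQ A))
    have hs : C.syndrome (restrict A R + (R + restrict A x)) = C.syndrome x := by
      rw [syndrome_add, syndrome_add, hsx, hsR, hR.2.1]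
      funext j
      simp only [Pi.add_apply]
      rw [add_left_comm, CharTwo.add_self_eq_zero, add_zero]
    have h5 := hR.2.2 _ hq hs
    have h6 : hammingNorm (restrict A R + (R + restrict A x)) + wtOn R A =
        hammingNorm R + wtOn x A := by
      rw [hammingNorm_add_wtOn (J := A) fun i hi => by simp [restrict, hi]]
      congr 1
      refine wtOn_congr fun i hi => ?_
      have := congrFun (Pauli.add_self R) i
      simp only [Pi.add_apply, restrict, hi, if_true] at this ⊢
      rw [← add_assoc, this, Pi.zero_apply, zero_add]
    omega
  have h7 : A.card ≤ wtOn x A + wtOn R A := by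
    unfold wtOn
    refine (Finset.card_le_card fun i hi => ?_).trans (Finset.card_union_le _ _)
    have := hA.1 hi
    rw [Finset.mem_union, Pauli.mem_supp, Pauli.mem_supp] at this
    simp only [Finset.mem_union, Finset.mem_filter]
    tauto
  have h8 : wtOn d A ≤ wtOn E A + 2 * κ * wtOn u (C.checksOn A) := by omega
  nlinarith

/-- Where confinement applies, the components of a minimal representative `R` of the residual error
are controlled by the syndrome error alone. -/
theorem IsMinWeightDecoder.card_le_of_confined (hD : C.IsMinWeightDecoder Q κ D)
    (hres : ∀ q ∈ Q, ∀ A, restrict A q ∈ Q) {T : ℕ}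
    (hconf : ∀ e ∈ Q, C.reducedWeight Q e < T →
      C.reducedWeight Q e ≤ κ * hammingNorm (C.syndrome e))
    (hR : C.IsMinRep Q (E + D (C.syndrome E + u)) R) {A : Finset (Fin C.n)}
    (hA : IsIsolated C.Adj A R.supp) (hT : A.card < T) :
    A.card ≤ 4 * κ * wtOn u (C.checksOn A) := by
  have hcyc := syndrome_cycle D E u
  set d := D (C.syndrome E + u) with hd
  have hs := syndrome_restrict hA subset_rfl
  have hw : wtOn R A = A.card := wtOn_eq_card_of_subset_supp hA.1
  have hs' := hs.trans (by rw [hR.2.1, hcyc])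
  have h1 := hD.exchange (hres R hR.1 A) hs'
  rw [← hd] at h1
  have h2 := hammingNorm_add_le d (restrict A R)
  have h3 := hconf _ (hres R hR.1 A)
  rw [hR.reducedWeight_restrict, hs', hammingNorm_restrict, hw] at h3
  rw [hammingNorm_restrict, hw] at h2
  have h4 := h3 hT
  have h5 := wtOn_add_le u (C.syndrome E + u + C.syndrome d) (C.checksOn A)
  generalize wtOn (C.syndrome E + u + C.syndrome d) (C.checksOn A) = V at *
  generalize wtOn u (C.checksOn A) = U at *
  generalize wtOn (u + (C.syndrome E + u + C.syndrome d)) (C.checksOn A) = X at *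
  -- Confinement bounds `|A|` by `κ (U + V)`, and `2 κ V ≤ |A| + 2 κ U` as the recovery is optimal.
  have h6 : A.card ≤ κ * U + κ * V := h4.trans (by rw [← mul_add]; exact Nat.mul_le_mul_left _ h5)
  have h7 : 2 * (κ * V) ≤ A.card + 2 * (κ * U) := by nlinarith
  nlinarith

/-- The state after a cycle with syndrome error `u`: up to a stabiliser, the residual error `x` is an
operator `R` in `Q` such that any union `A` of connected components of its support is bounded in size
by the weight of `u` on the checks that act on `A`. -/
def IsControlled (C : StabilizerCode) (Q : Submodule (ZMod 2) (Pauli C.n)) (κ : ℕ)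
    (x : Pauli C.n) (u : Fin C.m → ZMod 2) : Prop :=
  ∃ R ∈ Q, x + R ∈ C.stabilizer ∧
    ∀ A, IsIsolated C.Adj A R.supp → A.card ≤ 4 * κ * wtOn u (C.checksOn A)

/-- Sparse noise: a connected set of `T` or more qubits contains few errors in proportion to its
size. The constants are such that a cluster `M` with
`|M| ≤ 4 |e| + 20 κ |u'| + 4 κ |u|`, the errors being counted on `M` and on its checks, is not compatible
with sparse `e`, `u'` and `u`. -/
def IsSparse (C : StabilizerCode) (T κ : ℕ) (e : Pauli C.n) (u : Fin C.m → ZMod 2) : Prop :=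
  ∀ M, IsConn C.Adj M → T ≤ M.card →
    12 * wtOn e M < M.card ∧ 60 * κ * wtOn u (C.checksOn M) < M.card

/-- Sparse noise keeps the residual error controlled. -/
theorem IsControlled.cycle (hD : C.IsMinWeightDecoder Q κ D)
    (hres : ∀ q ∈ Q, ∀ A, restrict A q ∈ Q) {T : ℕ}
    (hdist : ∀ p, C.syndrome p = 0 → hammingNorm p < T → p ∈ C.stabilizer)
    (hconf : ∀ e ∈ Q, C.reducedWeight Q e < T →
      C.reducedWeight Q e ≤ κ * hammingNorm (C.syndrome e))
    {x e e' : Pauli C.n} {u u' : Fin C.m → ZMod 2} (hx : C.IsControlled Q κ x u')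
    (he : e ∈ Q) (hu' : C.IsSparse T κ e' u') (hu : C.IsSparse T κ e u) :
    C.IsControlled Q κ (C.cycle D x (e, u)) u := by
  obtain ⟨R', hR'Q, hxR', hR'⟩ := hx
  have hsymm : ∀ v w, C.Adj v w → C.Adj w v := fun _ _ => Adj.symm
  -- The decoder does not distinguish `x` from `R'`.
  have hsyn : C.syndrome x = C.syndrome R' := by
    have h := syndrome_eq_zero_of_mem_stabilizer hxR'
    rw [syndrome_add] at h
    funext j
    exact CharTwo.add_eq_zero.1 (congrFun h j)
  set E := R' + e with hE
  have hEQ : E ∈ Q := Q.add_mem hR'Q he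
  have hsE : C.syndrome (x + e) = C.syndrome E := by rw [syndrome_add, hsyn, hE, syndrome_add]
  set y := E + D (C.syndrome E + u) with hy
  obtain ⟨R, hR⟩ := exists_isMinRep (C := C) (Q.add_mem hEQ (hD (C.syndrome E + u)).1)
  rw [← hy] at hR
  -- By sparsity, components of the new errors have fewer than `T` qubits.
  have hsmall : ∀ M, IsIsolated C.Adj M (y.supp ∪ R.supp) → IsConn C.Adj M → M.card < T := by
    intro M hM hconn
    by_contra hT
    obtain ⟨A, hA, hMA, hMAconn⟩ := hconn.exists_hull hsymm R'.supp
    -- `M` together with the components `A` of the previous residual error that meet it satisfies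
    -- `|M ∪ A| ≤ 4 |e| + 20 κ |u'| + 4 κ |u|`.
    have h1 := hD.card_le hres hEQ (u := u) (R := R) hR hM
    have h2 := hR' A hA
    have h3 : wtOn E M ≤ A.card + wtOn e (M ∪ A) := by
      refine (wtOn_add_le R' e M).trans (add_le_add (Finset.card_le_card fun i hi => ?_)
        (wtOn_mono e Finset.subset_union_left))
      rw [Finset.mem_filter] at hi
      exact hMA (Finset.mem_inter.2 ⟨hi.1, Pauli.mem_supp.2 hi.2⟩)
    have h4 : (M ∪ A).card ≤ M.card + A.card := Finset.card_union_le _ _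
    have hTMA : T ≤ (M ∪ A).card :=
      (not_lt.1 hT).trans (Finset.card_le_card Finset.subset_union_left)
    have h5 := (hu _ hMAconn hTMA).1
    have h6 := (hu _ hMAconn hTMA).2
    have h7 := (hu' _ hMAconn hTMA).2
    have h8 := Nat.mul_le_mul_left κ
      (wtOn_mono u (checksOn_mono (C := C) (Finset.subset_union_left (s₁ := M) (s₂ := A))))
    have h9 := Nat.mul_le_mul_left κ
      (wtOn_mono u' (checksOn_mono (C := C) (Finset.subset_union_right (s₁ := M) (s₂ := A))))
    simp only [mul_assoc] at *
    omega
  refine ⟨R, hR.1, ?_, ?_⟩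
  · have hsupp : (y + R).supp ⊆ y.supp ∪ R.supp := by
      intro i hi
      rw [Finset.mem_union, Pauli.mem_supp, Pauli.mem_supp]
      rw [Pauli.mem_supp] at hi
      by_contra h
      push Not at h
      exact hi (by simp [h.1, h.2])
    have hyR : y + R ∈ C.stabilizer := by
      have key : ∀ A, IsIsolated C.Adj A (y.supp ∪ R.supp) → restrict A (y + R) ∈ C.stabilizer := by
        refine IsIsolated.induction hsymm (P := fun A => restrict A (y + R) ∈ C.stabilizer) ?_ ?_ ?_
        · have : restrict ∅ (y + R) = 0 := by funext i; simp [restrict]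
          rw [this]
          exact Submodule.zero_mem _
        · intro A hA _ hconn
          refine hdist _ ?_ ?_
          · rw [syndrome_restrict hA hsupp, syndrome_add, hR.2.1]
            funext j
            simp [restrict, CharTwo.add_self_eq_zero]
          · rw [hammingNorm_restrict]
            exact (wtOn_le_card _ _).trans_lt (hsmall A hA hconn)
        · intro A A' _ _ hd h1 h2
          rw [restrict_union _ hd]
          exact Submodule.add_mem _ h1 h2
      have h := key _ (IsIsolated.refl _ _)
      rwa [Pauli.restrict_supp hsupp] at h
    have h := C.stabilizer.add_mem hxR' hyR
    have heq : x + R' + (y + R) = C.cycle D x (e, u) + R := by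
      simp only [StabilizerCode.cycle, hy, hsE]
      calc x + R' + (E + D (C.syndrome E + u) + R)
          = (R' + R') + (x + e + D (C.syndrome E + u) + R) := by rw [hE]; abel
        _ = _ := by rw [Pauli.add_self, zero_add]
    rwa [heq] at h
  · refine IsIsolated.induction hsymm
      (P := fun A => A.card ≤ 4 * κ * wtOn u (C.checksOn A)) ?_ ?_ ?_
    · simp
    · intro A hA hne hconn
      refine hD.card_le_of_confined hres hconf hR hA ?_
      -- `A` lies in one component of the larger set.
      obtain ⟨B, hB, hAB, hconnB⟩ := hconn.exists_hull hsymm (y.supp ∪ R.supp)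
      have hAsub : A ⊆ B :=
        (Finset.subset_inter subset_rfl (hA.1.trans Finset.subset_union_right)).trans hAB
      rw [Finset.union_eq_right.2 hAsub] at hconnB
      exact (Finset.card_le_card hAsub).trans_lt (hsmall B hB hconnB)
    · intro A A' hA hA' hd h1 h2
      rw [Finset.card_union_of_disjoint hd, checksOn_union, wtOn_union _ (disjoint_checksOn hA hA' hd),
        mul_add]
      exact add_le_add h1 h2

theorem isSparse_zero {T : ℕ} (hT : 0 < T) : C.IsSparse T κ 0 0 := by
  intro M _ hM
  rw [wtOn_zero, wtOn_zero]
  omega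

/-- Sparse noise in every cycle does not make the decoder fail. -/
theorem not_fails_of_isSparse (hD : C.IsMinWeightDecoder Q κ D)
    (hres : ∀ q ∈ Q, ∀ A, restrict A q ∈ Q) {T : ℕ} (hT : 0 < T)
    (hdist : ∀ p, C.syndrome p = 0 → hammingNorm p < T → p ∈ C.stabilizer)
    (hconf : ∀ e ∈ Q, C.reducedWeight Q e < T →
      C.reducedWeight Q e ≤ κ * hammingNorm (C.syndrome e))
    {N : ℕ} {h : Fin N → C.Noise} (hQ : ∀ τ, (h τ).1 ∈ Q)
    (hs : ∀ τ, C.IsSparse T κ (h τ).1 (h τ).2) : ¬ C.Fails D h := by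
  have main : ∃ e u, C.IsSparse T κ e u ∧ C.IsControlled Q κ (C.residual D h) u := by
    induction N with
    | zero =>
      refine ⟨0, 0, isSparse_zero hT, 0, Q.zero_mem, ?_, ?_⟩
      · simp [residual]
      · intro A hA
        have : A = ∅ := by
          have := hA.1
          simpa [Pauli.supp] using this
        simp [this]
    | succ N ih =>
      obtain ⟨e, u, hsp, hc⟩ := ih (h := fun τ => h τ.castSucc) (fun τ => hQ _) (fun τ => hs _)
      refine ⟨_, _, hs (Fin.last N), ?_⟩
      have := hc.cycle hD hres hdist hconf (hQ (Fin.last N)) hsp (hs (Fin.last N))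
      unfold residual at this ⊢
      rwa [Fin.foldl_succ_last]
  obtain ⟨e, u, hsp, hc⟩ := main
  obtain ⟨R, -, hmem, hR⟩ := hc.cycle hD hres hdist hconf Q.zero_mem hsp (isSparse_zero hT)
  have hR0 : R = 0 := by
    have := hR R.supp (IsIsolated.refl _ _)
    rw [wtOn_zero, mul_zero, Nat.le_zero, Finset.card_eq_zero] at this
    funext i
    by_contra hi
    have := this ▸ Pauli.mem_supp.2 hi
    simp at this
  rw [hR0, add_zero] at hmem
  exact fun hf => hf hmem

end Cycle

end StabilizerCode

/-! ### The probability of dense clusters of errors -/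

open Classical in
/-- The connected sets of a graph of degree at most `Δ`, weighted by `(2 Δ²)⁻¹` per vertex. -/
theorem sum_isConn_le {V : Type*} [Fintype V] {nbr : V → Finset V}
    (hsymm : ∀ x y, y ∈ nbr x → x ∈ nbr y) {Δ : ℕ} (hΔ : ∀ v, (nbr v).card ≤ Δ) (hΔ1 : 1 ≤ Δ) :
    ∑ M : Finset V with IsConn (fun x y => y ∈ nbr x) M ∧ M.Nonempty,
      ((2 * (Δ : ℝ) ^ 2)⁻¹) ^ M.card ≤ (Fintype.card V : ℝ) := by
  have hgeom : ∀ k : ℕ, ∑ s ∈ Finset.Icc 1 k, (2⁻¹ : ℝ) ^ s ≤ 1 - 2⁻¹ ^ k := by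
    intro k
    induction k with
    | zero => simp
    | succ k ih =>
      rw [Finset.sum_Icc_succ_top (by omega), pow_succ]
      linarith
  have hΔ0 : (0 : ℝ) < Δ := by exact_mod_cast hΔ1
  rw [← Finset.sum_fiberwise_of_maps_to (g := Finset.card) (t := Finset.Icc 1 (Fintype.card V))
    (fun M hM => by
      simp only [Finset.mem_filter, Finset.mem_univ, true_and] at hM
      exact Finset.mem_Icc.2 ⟨Finset.card_pos.2 hM.2, Finset.card_le_univ M⟩)]
  calc _ ≤ ∑ s ∈ Finset.Icc 1 (Fintype.card V), (Fintype.card V : ℝ) * 2⁻¹ ^ s := by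
        refine Finset.sum_le_sum fun s hs => ?_
        rw [Finset.sum_congr rfl (g := fun _ => ((2 * (Δ : ℝ) ^ 2)⁻¹) ^ s)
          fun M hM => by rw [(Finset.mem_filter.1 hM).2], Finset.sum_const, nsmul_eq_mul]
        have hcard := card_isConn_le hsymm hΔ hΔ1 (Finset.mem_Icc.1 hs).1
        have hle := (Finset.card_le_card (s := (Finset.univ.filter fun M : Finset V =>
            IsConn (fun x y => y ∈ nbr x) M ∧ M.Nonempty).filter fun M => M.card = s)
          fun M hM => by
            simp only [Finset.mem_filter, Finset.mem_univ, true_and] at hM ⊢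
            exact ⟨hM.1.1, hM.2⟩).trans hcard
        replace hle := (Nat.cast_le (α := ℝ)).2 hle
        push_cast at hle
        refine (mul_le_mul_of_nonneg_right hle (by positivity)).trans_eq ?_
        rw [mul_assoc, ← mul_pow]
        congr 2
        field_simp
    _ ≤ _ := by
        rw [← Finset.mul_sum]
        have h1 := hgeom (Fintype.card V)
        have h2 : (0 : ℝ) ≤ 2⁻¹ ^ Fintype.card V := by positivity
        exact mul_le_of_le_one_right (by positivity) (by linarith)

/-- The Peierls bound: for a random vector `x` that is nonzero on `G` with probability at most
`p ^ |G|`, a connected set `M` of at least `T` vertices with at least `|M| / L` errors on the attached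
positions `att M` is unlikely. -/
theorem dense_cluster_prob_le {Ω V ι G : Type*} [Fintype V] [DecidableEq G] [Zero G]
    {nbr : V → Finset V} (hsymm : ∀ x y, y ∈ nbr x → x ∈ nbr y) {Δ : ℕ}
    (hΔ : ∀ v, (nbr v).card ≤ Δ) (hΔ1 : 1 ≤ Δ)
    {att : Finset V → Finset ι} {d : ℕ} (hatt : ∀ M, (att M).card ≤ d * M.card)
    (μ : PMF Ω) (x : Ω → ι → G) {p pth : ℝ} {L T : ℕ} (hL : 0 < L) (hT : 0 < T)
    (hpth : pth = (2 * (Δ : ℝ) ^ 2 * 2 ^ d)⁻¹ ^ L) (hp0 : 0 ≤ p) (hp : p ≤ pth)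
    (hx : ∀ S : Finset ι, μ.toOuterMeasure {o | ∀ j ∈ S, x o j ≠ 0} ≤ ENNReal.ofReal (p ^ S.card)) :
    μ.toOuterMeasure {o | ∃ M, IsConn (fun x y => y ∈ nbr x) M ∧ T ≤ M.card ∧
        M.card ≤ L * wtOn (x o) (att M)} ≤
      ENNReal.ofReal (Fintype.card V * (p / pth) ^ ((T : ℝ) / L)) := by
  classical
  have hΔ0 : (1 : ℝ) ≤ Δ := by exact_mod_cast hΔ1
  have hLne : L ≠ 0 := hL.ne'
  have hpth0 : 0 < pth := by rw [hpth]; positivity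
  -- `y` and `z = w * y` are the `L`-th roots of `p / pth` and of `p`.
  set y : ℝ := (p / pth) ^ ((L : ℝ)⁻¹) with hy
  have hy0 : 0 ≤ y := Real.rpow_nonneg (div_nonneg hp0 hpth0.le) _
  have hy1 : y ≤ 1 :=
    Real.rpow_le_one (div_nonneg hp0 hpth0.le) ((div_le_one hpth0).2 hp) (by positivity)
  have hyL : y ^ L = p / pth := Real.rpow_inv_natCast_pow (div_nonneg hp0 hpth0.le) hLne
  set w : ℝ := (2 * (Δ : ℝ) ^ 2 * 2 ^ d)⁻¹ with hw
  have hw0 : 0 < w := by positivity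
  have hw1 : w ≤ 1 := by
    refine inv_le_one_of_one_le₀ ?_
    have h1 : (1 : ℝ) ≤ (Δ : ℝ) ^ 2 := one_le_pow₀ hΔ0
    have h2 : (1 : ℝ) ≤ 2 ^ d := one_le_pow₀ (by norm_num)
    nlinarith
  set z : ℝ := w * y with hz
  have hz0 : 0 ≤ z := by positivity
  have hz1 : z ≤ 1 := mul_le_one₀ hw1 hy0 hy1
  have hzL : z ^ L = p := by rw [hz, mul_pow, hyL, ← hpth, mul_div_cancel₀ _ hpth0.ne']
  set 𝓜 : Finset (Finset V) :=
    Finset.univ.filter fun M => IsConn (fun x y => y ∈ nbr x) M ∧ T ≤ M.card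
  have hsub : {o | ∃ M, IsConn (fun x y => y ∈ nbr x) M ∧ T ≤ M.card ∧
      M.card ≤ L * wtOn (x o) (att M)} ⊆
      ⋃ M ∈ 𝓜, ⋃ S ∈ (att M).powerset.filter (fun S => M.card ≤ L * S.card),
        {o | ∀ j ∈ S, x o j ≠ 0} := by
    rintro o ⟨M, hM, hTM, hML⟩
    simp only [Set.mem_iUnion]
    refine ⟨M, by simp [𝓜, hM, hTM], (att M).filter fun j => x o j ≠ 0, ?_, ?_⟩
    · rw [Finset.mem_filter, Finset.mem_powerset]
      exact ⟨Finset.filter_subset _ _, hML⟩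
    · intro j hj
      exact (Finset.mem_filter.1 hj).2
  have hone : ∀ M ∈ 𝓜, μ.toOuterMeasure
      (⋃ S ∈ (att M).powerset.filter (fun S => M.card ≤ L * S.card), {o | ∀ j ∈ S, x o j ≠ 0}) ≤
      ENNReal.ofReal (y ^ T * ((2 * (Δ : ℝ) ^ 2)⁻¹) ^ M.card) := by
    intro M hM
    have hTM : T ≤ M.card := (Finset.mem_filter.1 hM).2.2
    refine (MeasureTheory.measure_biUnion_finset_le _ _).trans ?_
    refine (Finset.sum_le_card_nsmul _ _ (ENNReal.ofReal (z ^ M.card)) fun S hS => ?_).trans ?_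
    · refine (hx S).trans (ENNReal.ofReal_le_ofReal ?_)
      rw [← hzL, ← pow_mul]
      exact pow_le_pow_of_le_one hz0 hz1 (Finset.mem_filter.1 hS).2
    · rw [nsmul_eq_mul, ← ENNReal.ofReal_natCast, ← ENNReal.ofReal_mul (by positivity)]
      refine ENNReal.ofReal_le_ofReal ?_
      have hcard : ((((att M).powerset.filter fun S => M.card ≤ L * S.card).card : ℕ) : ℝ) ≤
          (2 ^ d) ^ M.card := by
        have := (Finset.card_filter_le (att M).powerset fun S => M.card ≤ L * S.card)
        rw [Finset.card_powerset] at this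
        rw [← pow_mul]
        exact_mod_cast this.trans (Nat.pow_le_pow_right (by norm_num) (hatt M))
      calc _ ≤ ((2 : ℝ) ^ d) ^ M.card * z ^ M.card :=
            mul_le_mul_of_nonneg_right hcard (by positivity)
        _ = y ^ M.card * ((2 * (Δ : ℝ) ^ 2)⁻¹) ^ M.card := by
            rw [← mul_pow, ← mul_pow]
            congr 1
            rw [hz, hw, mul_inv]
            field_simp
        _ ≤ _ := mul_le_mul_of_nonneg_right (pow_le_pow_of_le_one hy0 hy1 hTM) (by positivity)
  refine (MeasureTheory.measure_mono hsub).trans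
    ((MeasureTheory.measure_biUnion_finset_le _ _).trans ((Finset.sum_le_sum hone).trans ?_))
  rw [← ENNReal.ofReal_sum_of_nonneg fun M _ => by positivity, ← Finset.mul_sum]
  refine ENNReal.ofReal_le_ofReal ?_
  have hyT : y ^ T = (p / pth) ^ ((T : ℝ) / L) := by
    rw [hy, ← Real.rpow_natCast, ← Real.rpow_mul (div_nonneg hp0 hpth0.le)]
    congr 1
    field_simp
  rw [← hyT, mul_comm]
  refine mul_le_mul_of_nonneg_right (le_trans ?_ (sum_isConn_le hsymm hΔ hΔ1)) (by positivity)
  refine Finset.sum_le_sum_of_subset_of_nonneg (fun M hM => ?_) fun _ _ _ => by positivity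
  simp only [𝓜, Finset.mem_filter, Finset.mem_univ, true_and] at hM ⊢
  exact ⟨hM.1, Finset.card_pos.1 (hT.trans_le hM.2)⟩

namespace StabilizerCode

variable {C : StabilizerCode}

open Classical in
theorem card_adj_le {ω r : ℕ} (hdeg : ∀ v, C.qubitDegree v + 1 ≤ ω)
    (hrow : ∀ j, hammingNorm (C.gen j) ≤ r) (v : Fin C.n) :
    (Finset.univ.filter (C.Adj v)).card ≤ ω * r + 1 := by
  have : Finset.univ.filter (C.Adj v) ⊆
      (Finset.univ.filter fun j => C.gen j v ≠ 0).biUnion fun j => (C.gen j).supp := by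
    rintro w hw
    obtain ⟨j, h1, h2⟩ := (Finset.mem_filter.1 hw).2
    simp only [Finset.mem_biUnion, Finset.mem_filter, Finset.mem_univ, true_and]
    exact ⟨j, h1, Pauli.mem_supp.2 h2⟩
  refine ((Finset.card_le_card this).trans
    (Finset.card_biUnion_le_card_mul _ _ r fun j _ => hrow j)).trans ?_
  have : (Finset.univ.filter fun j => C.gen j v ≠ 0).card ≤ ω := (Nat.le_succ _).trans (hdeg v)
  nlinarith

/-- The failure probability of the decoder on one code, by a union bound over the cycles. -/
theorem IsMinWeightDecoder.worstFailure_le {Q : Submodule (ZMod 2) (Pauli C.n)} {κ : ℕ}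
    {D : C.Decoder} (hD : C.IsMinWeightDecoder Q κ D) (hκ : 0 < κ)
    (hres : ∀ q ∈ Q, ∀ A, restrict A q ∈ Q) {T : ℕ} (hT : 0 < T)
    (hdist : ∀ p, C.syndrome p = 0 → hammingNorm p < T → p ∈ C.stabilizer)
    (hconf : ∀ e ∈ Q, C.reducedWeight Q e < T →
      C.reducedWeight Q e ≤ κ * hammingNorm (C.syndrome e))
    {ω r : ℕ} (hdeg : ∀ v, C.qubitDegree v + 1 ≤ ω) (hrow : ∀ j, hammingNorm (C.gen j) ≤ r)
    {p q pth qth : ℝ} (hpth : pth = (2 * ((ω * r + 1 : ℕ) : ℝ) ^ 2 * 2 ^ 1)⁻¹ ^ 12)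
    (hqth : qth = (2 * ((ω * r + 1 : ℕ) : ℝ) ^ 2 * 2 ^ ω)⁻¹ ^ (60 * κ))
    (hp0 : 0 ≤ p) (hp : p ≤ pth) (hq0 : 0 ≤ q) (hq : q ≤ qth) (N : ℕ) :
    C.worstFailure Q D N p q ≤ ENNReal.ofReal (N * (C.n * (p / pth) ^ ((T : ℝ) / (12 : ℕ)) +
      C.n * (q / qth) ^ ((T : ℝ) / (60 * κ : ℕ)))) := by
  classical
  refine iSup₂_le fun μ hμ => ?_
  let nbr : Fin C.n → Finset (Fin C.n) := fun v => Finset.univ.filter (C.Adj v)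
  have hnbr : ∀ M, IsConn C.Adj M ↔ IsConn (fun x y => y ∈ nbr x) M := by
    intro M
    simp [nbr]
  have hsymm : ∀ x y, y ∈ nbr x → x ∈ nbr y := by
    intro x y hxy
    simp only [nbr, Finset.mem_filter, Finset.mem_univ, true_and] at hxy ⊢
    exact hxy.symm
  have hΔ : ∀ v, (nbr v).card ≤ ω * r + 1 := card_adj_le hdeg hrow
  let 𝓐 : Fin N → Set (Fin N → C.Noise) := fun τ => {h | ∃ M, IsConn (fun x y => y ∈ nbr x) M ∧
    T ≤ M.card ∧ M.card ≤ 12 * wtOn (h τ).1 M}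
  let 𝓑 : Fin N → Set (Fin N → C.Noise) := fun τ => {h | ∃ M, IsConn (fun x y => y ∈ nbr x) M ∧
    T ≤ M.card ∧ M.card ≤ 60 * κ * wtOn (h τ).2 (C.checksOn M)}
  have hsub : {h | C.Fails D h} ∩ μ.support ⊆ ⋃ τ, (𝓐 τ ∪ 𝓑 τ) := by
    rintro h ⟨hf, hsupp⟩
    by_contra hcon
    simp only [Set.mem_iUnion, Set.mem_union, not_exists, not_or] at hcon
    refine not_fails_of_isSparse hD hres hT hdist hconf (fun τ => hμ.mem h hsupp τ) ?_ hf
    intro τ M hM hTM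
    rw [hnbr] at hM
    constructor
    · by_contra hlt
      exact (hcon τ).1 ⟨M, hM, hTM, not_lt.1 hlt⟩
    · by_contra hlt
      exact (hcon τ).2 ⟨M, hM, hTM, not_lt.1 hlt⟩
  rw [← PMF.toOuterMeasure_apply_inter_support]
  refine (MeasureTheory.measure_mono hsub).trans
    ((MeasureTheory.measure_iUnion_fintype_le _ _).trans ?_)
  have hone : ∀ τ, μ.toOuterMeasure (𝓐 τ ∪ 𝓑 τ) ≤ ENNReal.ofReal
      (C.n * (p / pth) ^ ((T : ℝ) / (12 : ℕ)) + C.n * (q / qth) ^ ((T : ℝ) / (60 * κ : ℕ))) := by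
    intro τ
    have hpth0 : 0 < pth := by rw [hpth]; positivity
    have hqth0 : 0 < qth := by rw [hqth]; positivity
    refine (MeasureTheory.measure_union_le _ _).trans ?_
    rw [ENNReal.ofReal_add (by positivity) (by positivity)]
    refine add_le_add ?_ ?_
    · have h := dense_cluster_prob_le hsymm hΔ (Nat.succ_pos _) (att := fun M => M) (d := 1)
        (fun M => by simp) μ (fun h => (h τ).1) (by norm_num) hT hpth hp0 hp fun S => by
          refine le_trans (MeasureTheory.measure_mono ?_) (hμ.qubit τ S)
          intro h hh i hi
          exact Pauli.mem_supp.2 (hh i hi)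
      rwa [Fintype.card_fin] at h
    · have h := dense_cluster_prob_le hsymm hΔ (Nat.succ_pos _) (att := C.checksOn) (d := ω)
        (card_checksOn_le hdeg) μ (fun h => (h τ).2) (by positivity) hT hqth hq0 hq
        fun S => hμ.check τ S
      rwa [Fintype.card_fin] at h
  refine (Finset.sum_le_card_nsmul _ _ _ fun τ _ => hone τ).trans_eq ?_
  rw [Finset.card_univ, Fintype.card_fin, nsmul_eq_mul, ENNReal.ofReal_mul (by positivity),
    ENNReal.ofReal_natCast]

end StabilizerCode

/-! ### Thresholds -/

theorem tendsto_mul_rpow_mul_rpow {x c β : ℝ} (hx0 : 0 ≤ x) (hx1 : x < 1) (hc : 0 < c)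
    (hβ : 0 < β) : Tendsto (fun n : ℕ => (n : ℝ) * x ^ (c * (n : ℝ) ^ β)) atTop (𝓝 0) := by
  rcases hx0.eq_or_lt with rfl | hx
  · refine tendsto_const_nhds.congr' ?_
    filter_upwards [eventually_ge_atTop 1] with n hn
    have : (0 : ℝ) < n := by exact_mod_cast hn
    rw [Real.zero_rpow (by positivity), mul_zero]
  · have hlog : 0 < -(Real.log x * c) := by
      have := Real.log_neg hx hx1
      nlinarith
    have h := (tendsto_rpow_mul_exp_neg_mul_atTop_nhds_zero β⁻¹ _ hlog).comp
      ((tendsto_rpow_atTop hβ).comp tendsto_natCast_atTop_atTop)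
    refine h.congr fun n => ?_
    simp only [Function.comp_apply]
    rw [Real.rpow_rpow_inv (Nat.cast_nonneg n) hβ.ne', Real.rpow_def_of_pos hx]
    congr 2
    ring

/-- The scale `T` below which clusters of errors are harmless: operators of weight less than `T` are
corrected by confinement and are no logical operators. It grows as a power of `n`; for the finitely
many sizes on which the growth of `t` says nothing, `T = 1` will do, as only the identity has weight
less than `1`. -/
theorem exists_scale {ι : Type*} {C : ι → StabilizerCode}
    {Q : (n : ℕ) → Submodule (ZMod 2) (Pauli n)} {a b : ℝ} (ha : 0 < a) (hb : 0 < b)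
    (hdist : ∀ i : ι, ENNReal.ofReal (a * ((C i).n : ℝ) ^ b) ≤ ((C i).distance : ℝ≥0∞))
    (hconf : GoodLinearConfinement C Q) :
    ∃ (κ : ℕ) (T : ι → ℕ) (c β : ℝ), 0 < κ ∧ 0 < c ∧ 0 < β ∧ ∀ i,
      0 < T i ∧ c * ((C i).n : ℝ) ^ β ≤ T i ∧
      (∀ p, (C i).syndrome p = 0 → hammingNorm p < T i → p ∈ (C i).stabilizer) ∧
      ∀ e ∈ Q (C i).n, (C i).reducedWeight (Q (C i).n) e < T i →
        (C i).reducedWeight (Q (C i).n) e ≤ κ * hammingNorm ((C i).syndrome e) := by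
  obtain ⟨κ, hκ, t, ⟨b', hb', c', hc', n₀, ht⟩, hcf⟩ := hconf
  lift κ to ℕ using hκ.le
  set β := min b b' with hβ
  set c₀ := min a c' with hc₀
  have hβ0 : 0 < β := lt_min hb hb'
  have hc₀0 : 0 < c₀ := lt_min ha hc'
  have hn₀ : (0 : ℝ) < ((n₀ : ℝ) + 1)⁻¹ ^ β := by positivity
  refine ⟨κ, fun i => if n₀ ≤ (C i).n then max 1 ⌈c₀ * ((C i).n : ℝ) ^ β⌉₊ else 1,
    min c₀ (((n₀ : ℝ) + 1)⁻¹ ^ β), β, by exact_mod_cast hκ, lt_min hc₀0 hn₀, hβ0, fun i => ?_⟩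
  -- A weight below the scale is zero or bounded by a power of `n`.
  have hsplit : ∀ k < (if n₀ ≤ (C i).n then max 1 ⌈c₀ * ((C i).n : ℝ) ^ β⌉₊ else 1),
      k = 0 ∨ (n₀ ≤ (C i).n ∧ (k : ℝ) < a * ((C i).n : ℝ) ^ b ∧
        (k : ℝ) < c' * ((C i).n : ℝ) ^ b') := by
    intro k hk
    split_ifs at hk with hn
    · rcases lt_max_iff.1 hk with h | h
      · exact Or.inl (by omega)
      · rw [Nat.lt_ceil] at h
        right
        have hn1 : (1 : ℝ) ≤ (C i).n := by
          have : (C i).n ≠ 0 := by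
            intro h0
            rw [h0, Nat.cast_zero, Real.zero_rpow hβ0.ne', mul_zero] at h
            exact absurd h (not_lt.2 (Nat.cast_nonneg k))
          exact_mod_cast Nat.one_le_iff_ne_zero.2 this
        exact ⟨hn, h.trans_le (mul_le_mul (min_le_left _ _)
            (Real.rpow_le_rpow_of_exponent_le hn1 (min_le_left _ _)) (by positivity) ha.le),
          h.trans_le (mul_le_mul (min_le_right _ _)
            (Real.rpow_le_rpow_of_exponent_le hn1 (min_le_right _ _)) (by positivity) hc'.le)⟩
    · exact Or.inl (by omega)
  refine ⟨?_, ?_, ?_, ?_⟩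
  · dsimp only
    split_ifs <;> simp
  · dsimp only
    split_ifs with hn
    · refine (mul_le_mul_of_nonneg_right (min_le_left _ _) (by positivity)).trans ?_
      exact (Nat.le_ceil _).trans (by exact_mod_cast le_max_right _ _)
    · refine (mul_le_mul_of_nonneg_right (min_le_right _ _) (by positivity)).trans ?_
      rw [← Real.mul_rpow (by positivity) (by positivity), Nat.cast_one]
      refine Real.rpow_le_one (by positivity) ?_ hβ0.le
      rw [inv_mul_le_one₀ (by positivity)]
      have : (C i).n ≤ n₀ + 1 := by omega
      exact_mod_cast this
  · intro p hp hlt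
    rcases hsplit _ hlt with h | ⟨-, h, -⟩
    · rw [hammingNorm_eq_zero] at h
      rw [h]
      exact Submodule.zero_mem _
    · by_contra hmem
      have h1 : (C i).distance ≤ (hammingNorm p : ℕ∞) := iInf₂_le_of_le p hmem (iInf_le _ hp)
      have h2 : ((C i).distance : ℝ≥0∞) ≤ ((hammingNorm p : ℕ) : ℝ≥0∞) := by exact_mod_cast h1
      have h3 := (hdist i).trans h2
      rw [← ENNReal.ofReal_natCast, ENNReal.ofReal_le_ofReal_iff (by positivity)] at h3
      exact absurd h (not_lt.2 h3)
  · intro e he hlt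
    rcases hsplit _ hlt with h | ⟨hn, -, h⟩
    · rw [h]
      exact Nat.zero_le _
    · have h1 : (((C i).reducedWeight (Q (C i).n) e : ℤ) : ℝ) ≤ (t i : ℝ) := by
        rw [Int.cast_natCast]
        exact h.le.trans (ht i hn)
      have h2 := (hcf i).2.2 e he (by exact_mod_cast h1)
      dsimp only at h2
      exact_mod_cast h2

/-- All that is used of the class `Q` of errors is that it is closed under restriction to sets of
qubits. -/
theorem hasSustainableThreshold_of_goodLinearConfinement {ι : Type*} {C : ι → StabilizerCode}
    {Q : (n : ℕ) → Submodule (ZMod 2) (Pauli n)}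
    (hres : ∀ n, ∀ q ∈ Q n, ∀ A, restrict A q ∈ Q n) {ω r : ℕ}
    (hdeg : ∀ (i : ι) (v : Fin (C i).n), (C i).qubitDegree v + 1 ≤ ω)
    (hrow : ∀ (i : ι) (j : Fin (C i).m), hammingNorm ((C i).gen j) ≤ r)
    {a b : ℝ} (ha : 0 < a) (hb : 0 < b)
    (hdist : ∀ i : ι, ENNReal.ofReal (a * ((C i).n : ℝ) ^ b) ≤ ((C i).distance : ℝ≥0∞))
    (hconf : GoodLinearConfinement C Q) : HasSustainableThreshold C Q := by
  obtain ⟨κ, T, c, β, hκ, hc, hβ, hT⟩ := exists_scale ha hb hdist hconf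
  choose D hD using fun i => (C i).exists_isMinWeightDecoder (Q (C i).n) κ
  set pth : ℝ := (2 * ((ω * r + 1 : ℕ) : ℝ) ^ 2 * 2 ^ 1)⁻¹ ^ 12 with hpth
  set qth : ℝ := (2 * ((ω * r + 1 : ℕ) : ℝ) ^ 2 * 2 ^ ω)⁻¹ ^ (60 * κ) with hqth
  have hpth0 : 0 < pth := by positivity
  have hqth0 : 0 < qth := by positivity
  have hκ1 : (1 : ℝ) ≤ κ := by exact_mod_cast hκ
  set c₁ : ℝ := c / (60 * κ) with hc₁
  have hc₁0 : 0 < c₁ := by positivity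
  have bound : ∀ (i : ι) (N : ℕ) (p q : ℝ), 0 ≤ p → p ≤ pth → 0 ≤ q → q ≤ qth →
      (C i).worstFailure (Q (C i).n) (D i) N p q ≤ ENNReal.ofReal (1 * N * (C i).n *
        ((p / pth) ^ (c₁ * ((C i).n : ℝ) ^ β) + (q / qth) ^ (c₁ * ((C i).n : ℝ) ^ β))) := by
    intro i N p q hp0 hp hq0 hq
    obtain ⟨hT0, hTn, hdi, hci⟩ := hT i
    refine ((hD i).worstFailure_le hκ (hres _) hT0 hdi hci (hdeg i) (hrow i) hpth hqth hp0 hp hq0 hq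
      N).trans (ENNReal.ofReal_le_ofReal ?_)
    rw [one_mul, mul_assoc, ← mul_add]
    have hexp : c₁ * ((C i).n : ℝ) ^ β ≤ (T i : ℝ) / (60 * κ : ℕ) := by
      rw [hc₁, div_mul_eq_mul_div]
      push_cast
      exact div_le_div_of_nonneg_right hTn (by positivity)
    have hexp' : (T i : ℝ) / (60 * κ : ℕ) ≤ (T i : ℝ) / (12 : ℕ) := by
      push_cast
      exact div_le_div_of_nonneg_left (by positivity) (by norm_num) (by linarith)
    refine mul_le_mul_of_nonneg_left (mul_le_mul_of_nonneg_left (add_le_add ?_ ?_) (by positivity))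
      (by positivity)
    · exact Real.rpow_le_rpow_of_exponent_ge' (by positivity) ((div_le_one hpth0).2 hp)
        (by positivity) (hexp.trans hexp')
    · exact Real.rpow_le_rpow_of_exponent_ge' (by positivity) ((div_le_one hqth0).2 hq)
        (by positivity) hexp
  refine ⟨D, pth, qth, hpth0, hqth0, ?_, 1, c₁, β, one_pos, hc₁0, hβ, bound⟩
  intro N p q hp0 hp hq0 hq
  refine tendsto_of_tendsto_of_tendsto_of_le_of_le tendsto_const_nhds ?_ (fun _ => zero_le)
    (fun i => bound i N p q hp0 hp.le hq0 hq.le)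
  have h1 := tendsto_mul_rpow_mul_rpow (div_nonneg hp0 hpth0.le) ((div_lt_one hpth0).2 hp) hc₁0 hβ
  have h2 := tendsto_mul_rpow_mul_rpow (div_nonneg hq0 hqth0.le) ((div_lt_one hqth0).2 hq) hc₁0 hβ
  have h3 := ENNReal.tendsto_ofReal ((h1.add h2).const_mul (N : ℝ))
  rw [add_zero, mul_zero, ENNReal.ofReal_zero] at h3
  refine (h3.comp tendsto_comap).congr fun i => ?_
  simp only [Function.comp_apply]
  congr 1
  ring

theorem theorem2 {ι : Type*} (C : ι → StabilizerCode) (ω r : ℕ)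
    (hdeg : ∀ (i : ι) (v : Fin (C i).n), (C i).qubitDegree v + 1 ≤ ω)
    (hrow : ∀ (i : ι) (j : Fin (C i).m), hammingNorm ((C i).gen j) ≤ r)
    (a b : ℝ) (ha : 0 < a) (hb : 0 < b)
    (hdist : ∀ i : ι, ENNReal.ofReal (a * ((C i).n : ℝ) ^ b) ≤ ((C i).distance : ℝ≥0∞)) :
    (GoodLinearConfinement C pauliAll → HasSustainableThreshold C pauliAll) ∧
      (GoodLinearConfinement C pauliZ → HasSustainableThreshold C pauliZ) := by
  refine ⟨fun h => hasSustainableThreshold_of_goodLinearConfinement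
      (fun _ _ _ _ => Submodule.mem_top) hdeg hrow ha hb hdist h,
    fun h => hasSustainableThreshold_of_goodLinearConfinement
      (fun n q hq A i => ?_) hdeg hrow ha hb hdist h⟩
  have hq' : (q i).1 = 0 := hq i
  by_cases hi : i ∈ A <;> simp [restrict, hi, hq']
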